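/- Let $\mathbb{K}=\mathbb{R}$ or $\mathbb{C}$ and let $A=(a_{ij})\in\mathbb{Z}^{n\times n}$ be a generalized Cartan matrix ($a_{ii}=2$, and for $i\neq j$: $a_{ij}\le 0$ and $a_{ij}=0\Leftrightarrow a_{ji}=0$) which is irreducible and simply-laced, i.e. $a_{ij}\in\{0,-1\}$ for all $i\neq j$; $A$ need not be invertible. Let $\mathfrak{h}$ be a $\mathbb{K}$-vector space of dimension $2n-\operatorname{rank}A$ with linearly independent simple roots $\alpha_1,\dots,\alpha_n\in\mathfrak{h}^*$ and linearly independent simple coroots $\alpha_1^\vee,\dots,\alpha_n^\vee\in\mathfrak{h}$ such that $\alpha_j(\alpha_i^\vee)=a_{ij}$. Let $\mathfrak{g}(A)=\mathfrak{g}(A)(\mathbb{K})$ be the Kac-Moody algebra, i.e. the Lie algebra generated by the vector space $\mathfrak{h}$ and elements $e_1,\dots,e_n,f_1,\dots,f_n$ subject to the relations $$[h,h']=0,\quad [h,e_j]=\alpha_j(h)e_j,\quad [h,f_j]=-\alpha_j(h)f_j,\quad [e_i,f_j]=\delta_{ij}\alpha_i^\vee \qquad (h,h'\in\mathfrak{h})$$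 and $\operatorname{ad}(e_i)^{1-a_{ij}}(e_j)=0=\operatorname{ad}(f_i)^{1-a_{ij}}(f_j)$ for $i\neq j$. Let $\beta\in\mathfrak{h}^*$ be a positive real root (i.e. $\beta$ lies in the orbit of a simple root under the Weyl group, which is generated by the reflections $\lambda\mapsto\lambda-\lambda(\alpha_i^\vee)\alpha_i$, and is a combination of simple roots with non-negative integer coefficients) with maximal support, i.e. $\beta=\sum_{i=1}^n k_i\alpha_i$ with all $k_i\neq 0$. Let $e_\beta\neq 0$ be an element of the root space $\mathfrak{g}_\beta=\{x\in\mathfrak{g}(A) : [h,x]=\beta(h)x \ \forall h\in\mathfrak{h}\}$. Then the Lie subalgebra of $\mathfrak{g}(A)$ generated by $e_\beta,f_1,\dots,f_n$ is the derived algebra: $$\langle e_\beta,f_1,\dots,f_n\rangle_{\mathbb{K}}=\mathfrak{g}'(A)(\mathbb{K})=[\mathfrak{g}(A)(\mathbb{K}),\mathfrak{g}(A)(\mathbb{K})].$$ -/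

import Mathlib

noncomputable section

namespace KacMoody

/-- A generalized Cartan matrix (GCM) of size `n`: an integer matrix with `a i i = 2`, and, for
`i ≠ j`, `a i j ≤ 0` and `a i j = 0 ↔ a j i = 0`. -/
structure GCM (n : ℕ) where
  /-- The underlying matrix. -/
  a : Matrix (Fin n) (Fin n) ℤ
  diag : ∀ i, a i i = 2
  nonpos : ∀ i j, i ≠ j → a i j ≤ 0
  zero_iff : ∀ i j, i ≠ j → (a i j = 0 ↔ a j i = 0)

variable {n : ℕ}

/-- `A` is simply-laced if all its off-diagonal entries are `0` or `-1`. -/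
def GCM.IsSimplyLaced (A : GCM n) : Prop :=
  ∀ i j, i ≠ j → A.a i j = 0 ∨ A.a i j = -1

/-- `A` is irreducible (indecomposable) if the index set is not the union of two disjoint nonempty
sets `s`, `sᶜ` with `a i j = 0` for all `i ∈ s`, `j ∉ s`. -/
def GCM.IsIrreducible (A : GCM n) : Prop :=
  ∀ s : Set (Fin n), s.Nonempty → sᶜ.Nonempty → ∃ i ∈ s, ∃ j ∈ sᶜ, A.a i j ≠ 0

/-- A (minimal) realization of the GCM `A` over `K`, on the vector space `H` (the Cartan
subalgebra): linearly independent simple coroots `α i ^∨ ∈ H` and simple roots `α i ∈ H*`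
with `α j (α i ^∨) = a i j`, where `dim H = 2 n - rank A`. For invertible `A` this says that the
simple coroots are a basis of `H`. -/
structure Realization (A : GCM n) (K : Type*) [Field K] (H : Type*) [AddCommGroup H]
    [Module K H] where
  /-- The simple coroots. -/
  coroot : Fin n → H
  /-- The simple roots. -/
  root : Fin n → Module.Dual K H
  finiteDimensional : FiniteDimensional K H
  linearIndependent_coroot : LinearIndependent K coroot
  linearIndependent_root : LinearIndependent K root
  root_coroot : ∀ i j, root j (coroot i) = (A.a i j : K)
  finrank_add_rank : Module.finrank K H + (A.a.map (Int.cast : ℤ → K)).rank = 2 * n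

/-- Every GCM has a realization: on `K ^ n × (ker A)*`. -/
theorem Realization.nonempty (A : GCM n) (K : Type*) [Field K] :
    Nonempty (Realization A K
      ((Fin n → K) × Module.Dual K
        (LinearMap.ker (A.a.map (Int.cast : ℤ → K)).mulVecLin))) := by
  classical
  set M : Matrix (Fin n) (Fin n) K := A.a.map (Int.cast : ℤ → K) with hM
  obtain ⟨p, hp⟩ := (LinearMap.ker M.mulVecLin).exists_isCompl
  let π := (LinearMap.ker M.mulVecLin).projectionOnto p hp
  let r : Fin n → Module.Dual K ((Fin n → K) × Module.Dual K (LinearMap.ker M.mulVecLin)) :=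
    fun j => (∑ i, M i j • (LinearMap.proj i : (Fin n → K) →ₗ[K] K)).coprod
      (Module.Dual.eval K _ (π (Pi.single j 1)))
  refine ⟨⟨fun i => (Pi.single i 1, 0), r, inferInstance, ?_, ?_, ?_, ?_⟩⟩
  · have := (Pi.basisFun K (Fin n)).linearIndependent.map'
      (LinearMap.inl K (Fin n → K) (Module.Dual K (LinearMap.ker M.mulVecLin)))
      (LinearMap.ker_eq_bot.2 LinearMap.inl_injective)
    have he : (fun i : Fin n => ((Pi.single i 1 : Fin n → K),
        (0 : Module.Dual K (LinearMap.ker M.mulVecLin)))) =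
        LinearMap.inl K (Fin n → K) (Module.Dual K (LinearMap.ker M.mulVecLin)) ∘
          Pi.basisFun K (Fin n) := by
      funext i
      simp
    rw [he]
    exact this
  · rw [Fintype.linearIndependent_iff]
    intro c hc
    have hk : M.mulVec c = 0 := by
      funext i
      have h := LinearMap.congr_fun hc (Pi.single i 1, 0)
      simpa [r, Matrix.mulVec, dotProduct, Pi.single_apply, mul_comm] using h
    have hπ : π c = 0 := by
      rw [← Module.forall_dual_apply_eq_zero_iff K]
      intro ψ
      have h := LinearMap.congr_fun hc (0, ψ)
      have hcs : c = ∑ j, c j • (Pi.single j 1 : Fin n → K) := by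
        funext i
        simp [Finset.sum_apply, Pi.single_apply]
      rw [hcs, map_sum, map_sum]
      simpa [r] using h
    have hc0 : c = 0 := by
      have h := Submodule.projectionOnto_apply_left hp ⟨c, by simpa using hk⟩
      rw [show (LinearMap.ker M.mulVecLin).projectionOnto p hp c = 0 from hπ] at h
      simpa using (congrArg Subtype.val h).symm
    intro i
    simp [hc0]
  · intro i j
    simp [r, hM, Pi.single_apply]
  · have h := LinearMap.finrank_range_add_finrank_ker M.mulVecLin
    simp only [Module.finrank_fin_fun] at h
    have h2 : Module.finrank K ((Fin n → K) × Module.Dual K (LinearMap.ker M.mulVecLin)) =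
        n + Module.finrank K (LinearMap.ker M.mulVecLin) := by
      rw [Module.finrank_prod, Subspace.dual_finrank_eq, Module.finrank_fin_fun]
    have h3 : M.rank = Module.finrank K (LinearMap.range M.mulVecLin) := rfl
    change Module.finrank K ((Fin n → K) × Module.Dual K (LinearMap.ker M.mulVecLin)) + M.rank = _
    omega

/-- Generators of the Kac-Moody algebra: the elements of the Cartan subalgebra `H` and the
Chevalley generators `e i`, `f i`. -/
inductive Generator (n : ℕ) (H : Type*)
  | h : H → Generator n H
  | e : Fin n → Generator n H
  | f : Fin n → Generator n H

variable {A : GCM n} {K : Type*} [Field K] {H : Type*} [AddCommGroup H] [Module K H]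

namespace Realization

variable (R : Realization A K H)

local notation "hh" x => FreeLieAlgebra.of K (Generator.h x : Generator n H)
local notation "ee" x => FreeLieAlgebra.of K (Generator.e x : Generator n H)
local notation "ff" x => FreeLieAlgebra.of K (Generator.f x : Generator n H)

/-- The defining relators of the Kac-Moody algebra. The first two make `H → 𝔤(A)` linear; then
come `[h, h'] = 0`, `[h, e j] = α j (h) e j`, `[h, f j] = - α j (h) f j`,
`[e i, f j] = δ i j α i ^∨`, and the Serre relations. -/
inductive Relator : FreeLieAlgebra K (Generator n H) → Prop
  | h_add (x y : H) : Relator ((hh (x + y)) - (hh x) - (hh y))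
  | h_smul (c : K) (x : H) : Relator ((hh (c • x)) - c • (hh x))
  | h_h (x y : H) : Relator ⁅hh x, hh y⁆
  | h_e (x : H) (j : Fin n) : Relator (⁅hh x, ee j⁆ - R.root j x • (ee j))
  | h_f (x : H) (j : Fin n) : Relator (⁅hh x, ff j⁆ + R.root j x • (ff j))
  | e_f_same (i : Fin n) : Relator (⁅ee i, ff i⁆ - (hh (R.coroot i)))
  | e_f_ne (i j : Fin n) (hij : i ≠ j) : Relator ⁅ee i, ff j⁆
  | serre_e (i j : Fin n) (hij : i ≠ j) :
      Relator (((LieAlgebra.ad K (FreeLieAlgebra K (Generator n H)) (ee i)) ^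
        (1 - A.a i j).toNat) (ee j))
  | serre_f (i j : Fin n) (hij : i ≠ j) :
      Relator (((LieAlgebra.ad K (FreeLieAlgebra K (Generator n H)) (ff i)) ^
        (1 - A.a i j).toNat) (ff j))

/-- The Lie ideal of the free Lie algebra generated by the relators. -/
def relationIdeal : LieIdeal K (FreeLieAlgebra K (Generator n H)) :=
  LieSubmodule.lieSpan K _ {x | R.Relator x}

/-- The Kac-Moody algebra `𝔤(A)(K)`. -/
abbrev Algebra : Type _ := FreeLieAlgebra K (Generator n H) ⧸ R.relationIdeal

/-- The image in `𝔤(A)` of an element of the Cartan subalgebra. -/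
def h (x : H) : R.Algebra := LieSubmodule.Quotient.mk (hh x)

/-- The Chevalley generator `e i`. -/
def e (i : Fin n) : R.Algebra := LieSubmodule.Quotient.mk (ee i)

/-- The Chevalley generator `f i`. -/
def f (i : Fin n) : R.Algebra := LieSubmodule.Quotient.mk (ff i)

/-- The root space `𝔤_β = {x | [h, x] = β(h) x for all h ∈ H}`. -/
def rootSpace (β : Module.Dual K H) : Submodule K R.Algebra where
  carrier := {x | ∀ t : H, ⁅R.h t, x⁆ = β t • x}
  add_mem' hx hy t := by rw [lie_add, hx t, hy t, smul_add]
  zero_mem' t := by rw [lie_zero, smul_zero]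
  smul_mem' c x hx t := by rw [lie_smul, hx t, smul_comm]

/-- The derived algebra `𝔤'(A) = [𝔤(A), 𝔤(A)]`, as a Lie subalgebra of `𝔤(A)`. -/
def derivedAlgebra : LieSubalgebra K R.Algebra :=
  (LieAlgebra.derivedSeries K R.Algebra 1).toLieSubalgebra

/-- The simple reflection `r i : λ ↦ λ - λ(α i ^∨) α i` of `H*`. -/
def simpleReflection (i : Fin n) : Module.Dual K H ≃ₗ[K] Module.Dual K H :=
  Module.reflection (x := R.root i) (f := Module.Dual.eval K H (R.coroot i))
    (by simp [R.root_coroot, A.diag])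

/-- The Weyl group, generated by the simple reflections. -/
def weylGroup : Subgroup (Module.Dual K H ≃ₗ[K] Module.Dual K H) :=
  Subgroup.closure (Set.range R.simpleReflection)

/-- `β` is a real root: it is the image of a simple root under an element of the Weyl group. -/
def IsRealRoot (β : Module.Dual K H) : Prop :=
  ∃ w ∈ R.weylGroup, ∃ i, β = w (R.root i)

/-- `β` is a combination of the simple roots with coefficients in the natural numbers. -/
def IsPositive (β : Module.Dual K H) : Prop :=
  ∃ k : Fin n → ℕ, β = ∑ i, k i • R.root i

/-- `β` has maximal support: in its decomposition into simple roots all (integer) coefficients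
are nonzero. -/
def HasMaximalSupport (β : Module.Dual K H) : Prop :=
  ∃ k : Fin n → ℤ, β = ∑ i, k i • R.root i ∧ ∀ i, k i ≠ 0

end Realization

end KacMoody

end

/-!
Let `u ≠ 0` be a vector of weight `k ≥ 0` on which the invariant form is positive, and let `S` be a
subalgebra containing `u` and the `f j` for `j` in the support of `k`. Then `S` contains the `e j`
for `j` in that support, by induction on the height of `k`. Positivity of the form yields `i` in the
support with `p = k(α i ^∨) > 0`. By `𝔰𝔩₂`-theory `u' = ad(f i)^p u` is a nonzero vector of `S`, of
the smaller weight `r i k`, whose coordinates other than the `i`-th are those of `k`. If the `i`-th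
coordinate survives, the induction hypothesis applies. If it vanishes, then `ad(f i) u' = 0`, so
`[e i, u']` is a multiple of `ad(f i)^(p - 1) u` and lies in `S`. Now the induction hypothesis is
applied to the subalgebra `T` of those `x` normalizing `S` with `[x, e i] ∈ S`: it contains `u'` and
the `f j` for `j` in the support of `r i k`, hence also `e j` and `[e j, f j] = α j ^∨`. For a
neighbour `j` of `i` in that support, `[α j ^∨, e i]` is a nonzero multiple of `e i`, so `e i ∈ S`.
-/

noncomputable section

namespace KacMoody

section LieAlgebra

variable {K L : Type*} [CommRing K] [LieRing L] [LieAlgebra K L]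

open LieSubalgebra

/-- The annihilator of the class of `z` in `L ⧸ S`, for the action of the normalizer of `S`. -/
def annihilatorMod (S : LieSubalgebra K L) (z : L) : LieSubalgebra K L where
  carrier := {x | x ∈ S.normalizer ∧ ⁅x, z⁆ ∈ S}
  add_mem' hx hy := ⟨add_mem hx.1 hy.1, by rw [add_lie]; exact add_mem hx.2 hy.2⟩
  zero_mem' := ⟨zero_mem _, by rw [zero_lie]; exact zero_mem _⟩
  smul_mem' c x hx := ⟨S.normalizer.smul_mem c hx.1, by rw [smul_lie]; exact S.smul_mem c hx.2⟩
  lie_mem' {x y} hx hy := ⟨S.normalizer.lie_mem hx.1 hy.1, by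
    rw [lie_lie]
    exact sub_mem ((mem_normalizer_iff S x).1 hx.1 _ hy.2)
      ((mem_normalizer_iff S y).1 hy.1 _ hx.2)⟩

theorem mem_annihilatorMod {S : LieSubalgebra K L} {x z : L} :
    x ∈ annihilatorMod S z ↔ x ∈ S.normalizer ∧ ⁅x, z⁆ ∈ S :=
  Iff.rfl

theorem mem_annihilatorMod_of_mem {S : LieSubalgebra K L} {x z : L} (hx : x ∈ S)
    (hxz : ⁅x, z⁆ ∈ S) : x ∈ annihilatorMod S z :=
  ⟨S.le_normalizer hx, hxz⟩

theorem lie_mem_of_mem_lieSpan {s : Set L} {M : Submodule K L}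
    (hM : ∀ m ∈ M, ∀ b ∈ lieSpan K L s, ⁅m, b⁆ ∈ M) {y z : L} (hy : ∀ x ∈ s, ⁅y, x⁆ ∈ M)
    (hz : z ∈ lieSpan K L s) : ⁅y, z⁆ ∈ M := by
  induction hz using lieSpan_induction with
  | mem x hx => exact hy x hx
  | zero => rw [lie_zero]; exact zero_mem M
  | add a b _ _ ha hb => rw [lie_add]; exact add_mem ha hb
  | smul c a _ ha => rw [lie_smul]; exact M.smul_mem c ha
  | lie a b ha hb hya hyb =>
    rw [leibniz_lie, ← lie_skew a]
    exact add_mem (hM _ hya b hb) (neg_mem (hM _ hyb a ha))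

theorem mem_normalizer_lieSpan {s : Set L} {y : L} (hy : ∀ x ∈ s, ⁅y, x⁆ ∈ lieSpan K L s) :
    y ∈ (lieSpan K L s).normalizer :=
  (mem_normalizer_iff _ y).2 fun _ hz =>
    lie_mem_of_mem_lieSpan (M := (lieSpan K L s).toSubmodule)
      (fun _ hm _ hb => (lieSpan K L s).lie_mem hm hb) hy hz

theorem eq_top_of_forall_lie_mem {s : Set L} (hs : lieSpan K L s = ⊤) {M : Submodule K L}
    (hsM : s ⊆ M) (hM : ∀ x ∈ s, ∀ y ∈ M, ⁅x, y⁆ ∈ M) : M = ⊤ := by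
  have h (x : L) (hx : x ∈ lieSpan K L s) : x ∈ M ∧ ∀ y ∈ M, ⁅x, y⁆ ∈ M := by
    induction hx using lieSpan_induction with
    | mem x hx => exact ⟨hsM hx, hM x hx⟩
    | zero => exact ⟨zero_mem M, fun y _ => by rw [zero_lie]; exact zero_mem M⟩
    | add a b _ _ ha hb =>
      exact ⟨add_mem ha.1 hb.1, fun y hy => by rw [add_lie]; exact add_mem (ha.2 y hy) (hb.2 y hy)⟩
    | smul c a _ ha =>
      exact ⟨M.smul_mem c ha.1, fun y hy => by rw [smul_lie]; exact M.smul_mem c (ha.2 y hy)⟩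
    | lie a b _ _ ha hb =>
      refine ⟨ha.2 b hb.1, fun y hy => ?_⟩
      rw [lie_lie]
      exact sub_mem (ha.2 _ (hb.2 y hy)) (hb.2 _ (ha.2 y hy))
  exact eq_top_iff.2 fun x _ => (h x (hs ▸ mem_top x)).1

theorem lie_mem_of_mem_span {s t : Set L} {M : Submodule K L} (h : ∀ a ∈ s, ∀ b ∈ t, ⁅a, b⁆ ∈ M)
    {x y : L} (hx : x ∈ Submodule.span K s) (hy : y ∈ Submodule.span K t) : ⁅x, y⁆ ∈ M := by
  induction hx, hy using Submodule.span_induction₂ with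
  | mem_mem a b ha hb => exact h a ha b hb
  | zero_left y _ => rw [zero_lie]; exact zero_mem M
  | zero_right x _ => rw [lie_zero]; exact zero_mem M
  | add_left x y z _ _ _ hx hy => rw [add_lie]; exact add_mem hx hy
  | add_right x y z _ _ _ hy hz => rw [lie_add]; exact add_mem hy hz
  | smul_left c x y _ _ h => rw [smul_lie]; exact M.smul_mem c h
  | smul_right c x y _ _ h => rw [lie_smul]; exact M.smul_mem c h

end LieAlgebra

section SlTwo

open LieModule

variable {K L M : Type*} [CommRing K] [LieRing L] [LieAlgebra K L]
  [AddCommGroup M] [Module K M] [LieRingModule L M] [LieModule K L M]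
  {h e f : L} (t : IsSl2Triple h e f) {v : M}

include t

theorem lie_h_pow_toEnd_f {μ : K} (hv : ⁅h, v⁆ = μ • v) (n : ℕ) :
    ⁅h, (toEnd K L M f ^ n) v⁆ = (μ - 2 * n) • (toEnd K L M f ^ n) v := by
  induction n with
  | zero => simpa using hv
  | succ n ih =>
    rw [pow_succ', Module.End.mul_apply, toEnd_apply_apply, leibniz_lie h, t.lie_lie_smul_f K,
      ih, lie_smul, ← neg_smul, smul_lie, ← add_smul]
    congr 1
    push_cast
    ring

theorem lie_e_pow_succ_toEnd_f {μ : K} (hv : ⁅h, v⁆ = μ • v) (n : ℕ) :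
    ⁅e, (toEnd K L M f ^ (n + 1)) v⁆ =
      (toEnd K L M f ^ (n + 1)) ⁅e, v⁆ + ((n + 1) * (μ - n)) • (toEnd K L M f ^ n) v := by
  induction n with
  | zero => simp [leibniz_lie e, t.lie_e_f, hv, add_comm]
  | succ n ih =>
    rw [pow_succ' _ (n + 1), Module.End.mul_apply, toEnd_apply_apply, leibniz_lie e, t.lie_e_f,
      lie_h_pow_toEnd_f t hv, ih, lie_add, lie_smul, ← toEnd_apply_apply K L M f,
      ← toEnd_apply_apply K L M f, ← Module.End.mul_apply, ← Module.End.mul_apply, ← pow_succ',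
      ← pow_succ', add_left_comm, ← add_smul]
    congr 2
    push_cast
    ring

variable [IsDomain K] [CharZero K] [Module.IsTorsionFree K M]

theorem lie_e_eq_zero_of_pow_succ_toEnd_f_eq_zero {m : ℕ} (hv : ⁅h, v⁆ = (m : K) • v)
    (he : ∃ N : ℕ, (toEnd K L M e ^ N) v = 0) (hf : (toEnd K L M f ^ (m + 1)) v = 0) :
    ⁅e, v⁆ = 0 := by
  obtain ⟨N, hN⟩ := he
  induction N generalizing m v with
  | zero =>
    obtain rfl : v = 0 := by simpa using hN
    exact lie_zero e
  | succ N ih =>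
    have hf_succ {w : M} {r : ℕ} (hr : (toEnd K L M f ^ r) w = 0) :
        (toEnd K L M f ^ (r + 1)) w = 0 := by
      rw [pow_succ', Module.End.mul_apply, hr, map_zero]
    have hw : ⁅h, ⁅e, v⁆⁆ = ((m + 2 : ℕ) : K) • ⁅e, v⁆ := by
      rw [leibniz_lie, t.lie_h_e_smul K, hv, smul_lie, lie_smul, ← add_smul, add_comm]
      push_cast
      rfl
    have hfw : (toEnd K L M f ^ (m + 2)) ⁅e, v⁆ = 0 := by
      have := lie_e_pow_succ_toEnd_f t hv (m + 1)
      rwa [hf_succ hf, hf, lie_zero, smul_zero, add_zero, eq_comm] at this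
    have hew : ⁅e, ⁅e, v⁆⁆ = 0 := ih hw (hf_succ hfw) (by simpa [pow_succ] using hN)
    by_contra hw0
    have hprim : t.HasPrimitiveVectorWith ⁅e, v⁆ ((m + 2 : ℕ) : K) := ⟨hw0, hw, hew⟩
    exact hprim.pow_toEnd_f_ne_zero_of_eq_nat rfl le_rfl hfw

theorem eq_zero_of_pow_toEnd_f_eq_zero {m : ℕ} (hv : ⁅h, v⁆ = (m : K) • v)
    (he : ∃ N : ℕ, (toEnd K L M e ^ N) v = 0) (hf : (toEnd K L M f ^ m) v = 0) : v = 0 := by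
  have hev : ⁅e, v⁆ = 0 := lie_e_eq_zero_of_pow_succ_toEnd_f_eq_zero t hv he (by
    rw [pow_succ', Module.End.mul_apply, hf, map_zero])
  by_contra hv0
  have hprim : t.HasPrimitiveVectorWith v (m : K) := ⟨hv0, hv, hev⟩
  exact hprim.pow_toEnd_f_ne_zero_of_eq_nat rfl le_rfl hf

end SlTwo

theorem support_add_nontrivial {ι : Type*} {k l : ι → ℤ} (hk : 0 ≤ k) (hl : 0 ≤ l) {i j : ι}
    (hij : i ≠ j) (hi : k i ≠ 0 ∨ l i ≠ 0) (hj : k j ≠ 0 ∨ l j ≠ 0) :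
    (Function.support (k + l)).Nontrivial := by
  have := hk i; have := hl i; have := hk j; have := hl j
  refine ⟨i, ?_, j, ?_, hij⟩ <;>
  · simp only [Function.mem_support, Pi.add_apply, Pi.zero_apply] at *
    omega

open scoped Matrix

namespace GCM

variable {n : ℕ} (A : GCM n)

/-- The vector `d` of positive integers symmetrizes `A`, i.e. `diag(d) A` is symmetric. -/
structure IsSymmetrizer (d : Fin n → ℤ) : Prop where
  pos : ∀ i, 0 < d i
  symm : ∀ i j, d i * A.a i j = d j * A.a j i

/-- The quadratic form of the matrix `diag(d) A`, on coordinates in the simple roots; for a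
symmetrizer `d` it is invariant under the Weyl group. -/
def quadForm (d k : Fin n → ℤ) : ℤ := k ⬝ᵥ (d * A.a *ᵥ k)

/-- The simple reflection `r i` on coordinates in the simple roots. -/
def reflect (i : Fin n) (k : Fin n → ℤ) : Fin n → ℤ := k - Pi.single i ((A.a *ᵥ k) i)

variable {A} {d : Fin n → ℤ}

theorem reflect_apply_of_ne {i j : Fin n} (hji : j ≠ i) (k : Fin n → ℤ) :
    A.reflect i k j = k j := by
  simp [reflect, hji]

theorem mulVec_reflect_self (i : Fin n) (k : Fin n → ℤ) :
    (A.a *ᵥ A.reflect i k) i = -(A.a *ᵥ k) i := by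
  simp only [reflect, Matrix.mulVec_sub, Pi.sub_apply, Matrix.mulVec_single, Pi.smul_apply,
    Matrix.col_apply, A.diag, MulOpposite.smul_eq_mul_unop, MulOpposite.unop_op]
  ring

theorem IsSimplyLaced.isSymmetrizer_one (hA : A.IsSimplyLaced) : A.IsSymmetrizer 1 where
  pos _ := zero_lt_one
  symm i j := by
    rcases eq_or_ne i j with rfl | hij
    · rfl
    · have := A.zero_iff i j hij
      rcases hA i j hij with h | h <;> rcases hA j i hij.symm with h' | h' <;> simp_all

theorem quadForm_single_one (i : Fin n) : A.quadForm d (Pi.single i 1) = 2 * d i := by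
  simp [quadForm, A.diag, mul_comm]

theorem ne_zero_of_quadForm_pos {k : Fin n → ℤ} (hq : 0 < A.quadForm d k) : k ≠ 0 := by
  rintro rfl
  rw [quadForm, zero_dotProduct] at hq
  exact hq.false

namespace IsSymmetrizer

variable (hd : A.IsSymmetrizer d)
include hd

theorem dotProduct_comm (k l : Fin n → ℤ) :
    k ⬝ᵥ (d * A.a *ᵥ l) = l ⬝ᵥ (d * A.a *ᵥ k) := by
  simp only [dotProduct, Matrix.mulVec, Pi.mul_apply, Finset.mul_sum]
  rw [Finset.sum_comm]
  refine Finset.sum_congr rfl fun i _ => Finset.sum_congr rfl fun j _ => ?_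
  linear_combination k j * l i * hd.symm j i

theorem quadForm_reflect (i : Fin n) (k : Fin n → ℤ) :
    A.quadForm d (A.reflect i k) = A.quadForm d k := by
  have h (c : ℤ) : A.quadForm d (k - Pi.single i c) =
      A.quadForm d k - 2 * c * (d i * (A.a *ᵥ k) i) + 2 * c ^ 2 * d i := by
    simp only [quadForm, Matrix.mulVec_sub, mul_sub, sub_dotProduct, dotProduct_sub,
      hd.dotProduct_comm k, single_dotProduct]
    simp [A.diag]
    ring
  rw [reflect, h]
  ring

theorem exists_pos_pos_of_quadForm_pos {k : Fin n → ℤ} (hk : 0 ≤ k) (hq : 0 < A.quadForm d k) :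
    ∃ i, 0 < k i ∧ 0 < (A.a *ᵥ k) i := by
  contrapose! hq
  change ∑ i, k i * (d i * (A.a *ᵥ k) i) ≤ 0
  refine Finset.sum_nonpos fun i _ => ?_
  rcases (hk i).eq_or_lt with hi | hi
  · rw [← hi, Pi.zero_apply, zero_mul]
  · exact mul_nonpos_of_nonneg_of_nonpos hi.le
      (mul_nonpos_of_nonneg_of_nonpos (hd.pos i).le (hq i hi))

end IsSymmetrizer

end GCM

variable {n : ℕ} {A : GCM n} {K : Type*} [Field K] {H : Type*} [AddCommGroup H] [Module K H]

namespace Realization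

variable (R : Realization A K H)

/-- The quotient map from the free Lie algebra onto the Kac-Moody algebra. -/
def proj : FreeLieAlgebra K (Generator n H) →ₗ⁅K⁆ R.Algebra :=
  { (LieSubmodule.Quotient.mk' R.relationIdeal : _ →ₗ[K] R.Algebra) with
    map_lie' := rfl }

theorem proj_eq_zero_of_relator {x : FreeLieAlgebra K (Generator n H)} (hx : R.Relator x) :
    R.proj x = 0 :=
  LieSubmodule.Quotient.mk_eq_zero'.2 (LieSubmodule.subset_lieSpan hx)

/-- The map from `H` to the Kac-Moody algebra, as a linear map. -/
def hLin : H →ₗ[K] R.Algebra where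
  toFun := R.h
  map_add' x y := by
    have h := R.proj_eq_zero_of_relator (.h_add x y)
    rwa [map_sub, map_sub, sub_sub, sub_eq_zero] at h
  map_smul' c x := by
    have h := R.proj_eq_zero_of_relator (.h_smul c x)
    rwa [map_sub, map_smul, sub_eq_zero] at h

theorem lie_h_h (x y : H) : ⁅R.h x, R.h y⁆ = 0 := by
  have h := R.proj_eq_zero_of_relator (.h_h x y)
  rwa [LieHom.map_lie] at h

theorem lie_h_e (x : H) (j : Fin n) : ⁅R.h x, R.e j⁆ = R.root j x • R.e j := by
  have h := R.proj_eq_zero_of_relator (.h_e x j)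
  rwa [map_sub, map_smul, LieHom.map_lie, sub_eq_zero] at h

theorem lie_h_f (x : H) (j : Fin n) : ⁅R.h x, R.f j⁆ = -(R.root j x • R.f j) := by
  have h := R.proj_eq_zero_of_relator (.h_f x j)
  rwa [map_add, map_smul, LieHom.map_lie, ← eq_neg_iff_add_eq_zero] at h

theorem lie_e_f_same (i : Fin n) : ⁅R.e i, R.f i⁆ = R.h (R.coroot i) := by
  have h := R.proj_eq_zero_of_relator (.e_f_same i)
  rwa [map_sub, LieHom.map_lie, sub_eq_zero] at h

theorem lie_e_f_of_ne {i j : Fin n} (hij : i ≠ j) : ⁅R.e i, R.f j⁆ = 0 := by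
  have h := R.proj_eq_zero_of_relator (.e_f_ne i j hij)
  rwa [LieHom.map_lie] at h

theorem ad_e_pow_e {i j : Fin n} (hij : i ≠ j) :
    (LieAlgebra.ad K R.Algebra (R.e i) ^ (1 - A.a i j).toNat) (R.e j) = 0 := by
  have map_ad_pow (x y : FreeLieAlgebra K (Generator n H)) (N : ℕ) :
      R.proj ((LieAlgebra.ad K _ x ^ N) y) = (LieAlgebra.ad K _ (R.proj x) ^ N) (R.proj y) := by
    induction N with
    | zero => rfl
    | succ N ih => simp only [pow_succ', Module.End.mul_apply, LieAlgebra.ad_apply,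
        LieHom.map_lie, ih]
  have h := R.proj_eq_zero_of_relator (.serre_e i j hij)
  rwa [map_ad_pow] at h

/-- The generators of the Kac-Moody algebra: the image of `H` and the Chevalley generators. -/
def generators : Set R.Algebra := Set.range R.h ∪ (Set.range R.e ∪ Set.range R.f)

theorem lieSpan_generators : LieSubalgebra.lieSpan K R.Algebra R.generators = ⊤ := by
  set S := LieSubalgebra.lieSpan K R.Algebra R.generators
  let φ : FreeLieAlgebra K (Generator n H) →ₗ⁅K⁆ S := FreeLieAlgebra.lift K fun
    | .h x => ⟨R.h x, LieSubalgebra.subset_lieSpan (.inl ⟨x, rfl⟩)⟩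
    | .e i => ⟨R.e i, LieSubalgebra.subset_lieSpan (.inr (.inl ⟨i, rfl⟩))⟩
    | .f i => ⟨R.f i, LieSubalgebra.subset_lieSpan (.inr (.inr ⟨i, rfl⟩))⟩
  have hφ : S.incl.comp φ = R.proj := by
    refine FreeLieAlgebra.hom_ext fun g => ?_
    rcases g with x | i | i <;>
    · simp only [φ, LieHom.comp_apply, FreeLieAlgebra.lift_of_apply]
      rfl
  refine eq_top_iff.2 fun x _ => ?_
  obtain ⟨y, rfl⟩ := LieSubmodule.Quotient.surjective_mk' R.relationIdeal x
  exact LieHom.congr_fun hφ y ▸ (φ y).2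

variable {R} in
theorem eq_top_of_generators_mem {S : LieSubalgebra K R.Algebra} (hh : ∀ x, R.h x ∈ S)
    (he : ∀ i, R.e i ∈ S) (hf : ∀ i, R.f i ∈ S) : S = ⊤ := by
  rw [eq_top_iff, ← R.lieSpan_generators, LieSubalgebra.lieSpan_le]
  rintro _ (⟨x, rfl⟩ | ⟨i, rfl⟩ | ⟨i, rfl⟩)
  exacts [hh x, he i, hf i]

theorem exists_ad_e_pow_eq_zero (i : Fin n) (x : R.Algebra) :
    ∃ N : ℕ, (LieAlgebra.ad K R.Algebra (R.e i) ^ N) x = 0 := by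
  set E := LieSubalgebra.engel K (R.e i)
  have mem_of_lie_mem {y : R.Algebra} (hy : ⁅R.e i, y⁆ ∈ E) : y ∈ E := by
    obtain ⟨N, hN⟩ := (LieSubalgebra.mem_engel_iff K _ _).1 hy
    exact (LieSubalgebra.mem_engel_iff K _ _).2 ⟨N + 1, by rwa [pow_succ]⟩
  have hh (t : H) : R.h t ∈ E := by
    refine mem_of_lie_mem ?_
    rw [← lie_skew, lie_h_e]
    exact neg_mem (E.smul_mem _ (LieSubalgebra.self_mem_engel K _))
  have hE : E = ⊤ := by
    refine eq_top_of_generators_mem hh (fun j => ?_) fun j => mem_of_lie_mem ?_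
    · rcases eq_or_ne i j with rfl | hij
      · exact LieSubalgebra.self_mem_engel K _
      · exact (LieSubalgebra.mem_engel_iff K _ _).2 ⟨_, R.ad_e_pow_e hij⟩
    · rcases eq_or_ne i j with rfl | hij
      · rw [lie_e_f_same]
        exact hh _
      · rw [R.lie_e_f_of_ne hij]
        exact zero_mem E
  exact (LieSubalgebra.mem_engel_iff K _ _).1 (hE.ge (LieSubalgebra.mem_top x))

/-- The element of the root lattice with given integral coordinates in the simple roots. -/
def wt : (Fin n → ℤ) →ₗ[ℤ] Module.Dual K H := Fintype.linearCombination ℤ R.root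

theorem wt_apply (k : Fin n → ℤ) : R.wt k = ∑ i, k i • R.root i :=
  Fintype.linearCombination_apply ℤ R.root k

theorem wt_single (i : Fin n) (c : ℤ) : R.wt (Pi.single i c) = c • R.root i :=
  Fintype.linearCombination_apply_single ℤ R.root i c

theorem wt_injective [CharZero K] : Function.Injective R.wt :=
  (R.linearIndependent_root.restrict_scalars' ℤ).fintypeLinearCombination_injective

theorem wt_coroot (k : Fin n → ℤ) (i : Fin n) :
    R.wt k (R.coroot i) = (((A.a *ᵥ k) i : ℤ) : K) := by
  simp [wt_apply, R.root_coroot, Matrix.mulVec, dotProduct, mul_comm]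

theorem lie_mem_rootSpace {β γ : Module.Dual K H} {x y : R.Algebra} (hx : x ∈ R.rootSpace β)
    (hy : y ∈ R.rootSpace γ) : ⁅x, y⁆ ∈ R.rootSpace (β + γ) := by
  intro t
  rw [leibniz_lie, hx t, hy t, smul_lie, lie_smul, ← add_smul, LinearMap.add_apply]

theorem e_mem_rootSpace (i : Fin n) : R.e i ∈ R.rootSpace (R.wt (Pi.single i 1)) := by
  intro t
  rw [lie_h_e, wt_single, one_smul]

theorem f_mem_rootSpace (i : Fin n) : R.f i ∈ R.rootSpace (R.wt (-Pi.single i 1)) := by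
  intro t
  rw [lie_h_f, map_neg, wt_single, one_smul, LinearMap.neg_apply, neg_smul]

/-- The image of `H` in the Kac-Moody algebra. -/
def cartan : Submodule K R.Algebra := LinearMap.range R.hLin

/-- The subalgebra `𝔫₊` generated by the `e i`. -/
def nPos : LieSubalgebra K R.Algebra := LieSubalgebra.lieSpan K R.Algebra (Set.range R.e)

/-- The subalgebra `𝔫₋` generated by the `f i`. -/
def nNeg : LieSubalgebra K R.Algebra := LieSubalgebra.lieSpan K R.Algebra (Set.range R.f)

theorem h_mem_cartan (t : H) : R.h t ∈ R.cartan := ⟨t, rfl⟩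

theorem e_mem_nPos (i : Fin n) : R.e i ∈ R.nPos := LieSubalgebra.subset_lieSpan ⟨i, rfl⟩

theorem f_mem_nNeg (i : Fin n) : R.f i ∈ R.nNeg := LieSubalgebra.subset_lieSpan ⟨i, rfl⟩

theorem lie_e_f_mem_cartan (i j : Fin n) : ⁅R.e i, R.f j⁆ ∈ R.cartan := by
  rcases eq_or_ne i j with rfl | hij
  · rw [lie_e_f_same]
    exact R.h_mem_cartan _
  · rw [R.lie_e_f_of_ne hij]
    exact zero_mem _

theorem lie_h_mem_lieSpan {s : Set R.Algebra} (hs : ∀ x ∈ s, ∃ β, x ∈ R.rootSpace β) (t : H)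
    {z : R.Algebra} (hz : z ∈ LieSubalgebra.lieSpan K R.Algebra s) :
    ⁅R.h t, z⁆ ∈ LieSubalgebra.lieSpan K R.Algebra s := by
  refine (LieSubalgebra.mem_normalizer_iff _ _).1 (mem_normalizer_lieSpan fun x hx => ?_) z hz
  obtain ⟨β, hβ⟩ := hs x hx
  rw [hβ t]
  exact LieSubalgebra.smul_mem _ _ (LieSubalgebra.subset_lieSpan hx)

theorem lie_mem_cartan_sup_lieSpan {s : Set R.Algebra} (hs : ∀ x ∈ s, ∃ β, x ∈ R.rootSpace β)
    {y z : R.Algebra} (hy : ∀ x ∈ s, ⁅y, x⁆ ∈ R.cartan)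
    (hz : z ∈ LieSubalgebra.lieSpan K R.Algebra s) :
    ⁅y, z⁆ ∈ R.cartan ⊔ (LieSubalgebra.lieSpan K R.Algebra s).toSubmodule := by
  refine lie_mem_of_mem_lieSpan (fun m hm b hb => Submodule.mem_sup_right ?_)
    (fun x hx => Submodule.mem_sup_left (hy x hx)) hz
  obtain ⟨_, ⟨t, rfl⟩, c, hc, rfl⟩ := Submodule.mem_sup.1 hm
  rw [add_lie]
  exact add_mem (R.lie_h_mem_lieSpan hs t hb) (LieSubalgebra.lie_mem _ hc hb)

theorem exists_mem_rootSpace_of_mem_range_e : ∀ x ∈ Set.range R.e, ∃ β, x ∈ R.rootSpace β := by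
  rintro _ ⟨i, rfl⟩
  exact ⟨_, R.e_mem_rootSpace i⟩

theorem exists_mem_rootSpace_of_mem_range_f : ∀ x ∈ Set.range R.f, ∃ β, x ∈ R.rootSpace β := by
  rintro _ ⟨i, rfl⟩
  exact ⟨_, R.f_mem_rootSpace i⟩

theorem lie_e_mem_cartan_sup_nNeg (i : Fin n) {z : R.Algebra} (hz : z ∈ R.nNeg) :
    ⁅R.e i, z⁆ ∈ R.cartan ⊔ R.nNeg.toSubmodule := by
  refine R.lie_mem_cartan_sup_lieSpan R.exists_mem_rootSpace_of_mem_range_f ?_ hz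
  rintro _ ⟨j, rfl⟩
  exact R.lie_e_f_mem_cartan i j

theorem lie_f_mem_cartan_sup_nPos (i : Fin n) {z : R.Algebra} (hz : z ∈ R.nPos) :
    ⁅R.f i, z⁆ ∈ R.cartan ⊔ R.nPos.toSubmodule := by
  refine R.lie_mem_cartan_sup_lieSpan R.exists_mem_rootSpace_of_mem_range_e ?_ hz
  rintro _ ⟨j, rfl⟩
  rw [← lie_skew]
  exact neg_mem (R.lie_e_f_mem_cartan j i)

theorem cartan_sup_nPos_sup_nNeg :
    R.cartan ⊔ R.nPos.toSubmodule ⊔ R.nNeg.toSubmodule = ⊤ := by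
  set M := R.cartan ⊔ R.nPos.toSubmodule ⊔ R.nNeg.toSubmodule
  have hcM : R.cartan ≤ M := le_sup_left.trans le_sup_left
  have hpM : R.nPos.toSubmodule ≤ M := le_sup_right.trans le_sup_left
  have hnM : R.nNeg.toSubmodule ≤ M := le_sup_right
  have lie_mem {x : R.Algebra} (hc : ∀ t, ⁅x, R.h t⁆ ∈ M) (hp : ∀ y ∈ R.nPos, ⁅x, y⁆ ∈ M)
      (hn : ∀ y ∈ R.nNeg, ⁅x, y⁆ ∈ M) : ∀ y ∈ M, ⁅x, y⁆ ∈ M := by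
    suffices M ≤ M.comap (LieAlgebra.ad K R.Algebra x : _ →ₗ[K] _) from this
    refine sup_le (sup_le ?_ hp) hn
    rintro _ ⟨t, rfl⟩
    exact hc t
  refine eq_top_of_forall_lie_mem R.lieSpan_generators ?_ ?_
  · rintro _ (⟨t, rfl⟩ | ⟨i, rfl⟩ | ⟨i, rfl⟩)
    exacts [hcM (R.h_mem_cartan t), hpM (R.e_mem_nPos i), hnM (R.f_mem_nNeg i)]
  · rintro _ (⟨t, rfl⟩ | ⟨i, rfl⟩ | ⟨i, rfl⟩)
    · refine lie_mem (fun s => ?_)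
        (fun y hy => hpM (R.lie_h_mem_lieSpan R.exists_mem_rootSpace_of_mem_range_e t hy))
        (fun y hy => hnM (R.lie_h_mem_lieSpan R.exists_mem_rootSpace_of_mem_range_f t hy))
      rw [lie_h_h]
      exact zero_mem M
    · refine lie_mem (fun s => ?_) (fun y hy => hpM (R.nPos.lie_mem (R.e_mem_nPos i) hy))
        (fun y hy => sup_le hcM hnM (R.lie_e_mem_cartan_sup_nNeg i hy))
      rw [← lie_skew, lie_h_e]
      exact neg_mem (M.smul_mem _ (hpM (R.e_mem_nPos i)))
    · refine lie_mem (fun s => ?_)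
        (fun y hy => sup_le hcM hpM (R.lie_f_mem_cartan_sup_nPos i hy))
        (fun y hy => hnM (R.nNeg.lie_mem (R.f_mem_nNeg i) hy))
      rw [← lie_skew, lie_h_f, neg_neg]
      exact M.smul_mem _ (hnM (R.f_mem_nNeg i))

theorem wt_reflect (i : Fin n) (k : Fin n → ℤ) :
    R.wt (A.reflect i k) = R.simpleReflection i (R.wt k) := by
  rw [GCM.reflect, map_sub, wt_single, simpleReflection, Module.reflection_apply,
    Module.Dual.eval_apply, wt_coroot, Int.cast_smul_eq_zsmul]

open scoped Pointwise in
variable {R} in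
theorem IsRealRoot.exists_quadForm_pos {d : Fin n → ℤ} (hd : A.IsSymmetrizer d)
    {β : Module.Dual K H} (hβ : R.IsRealRoot β) : ∃ k, β = R.wt k ∧ 0 < A.quadForm d k := by
  set Q : Set (Module.Dual K H) := R.wt '' {k | 0 < A.quadForm d k}
  have simpleReflection_mem (i : Fin n) {γ} (hγ : γ ∈ Q) : R.simpleReflection i γ ∈ Q := by
    obtain ⟨k, hk, rfl⟩ := hγ
    exact ⟨A.reflect i k, by rwa [Set.mem_ofPred_eq, hd.quadForm_reflect], R.wt_reflect i k⟩
  have weylGroup_le : R.weylGroup ≤ MulAction.stabilizer _ Q := by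
    refine (Subgroup.closure_le _).2 ?_
    rintro _ ⟨i, rfl⟩
    refine MulAction.mem_stabilizer_set.2 fun γ => ⟨fun h => ?_, simpleReflection_mem i⟩
    have := simpleReflection_mem i h
    rwa [LinearEquiv.smul_def, simpleReflection, Module.involutive_reflection] at this
  obtain ⟨w, hw, i, rfl⟩ := hβ
  have root_mem : R.root i ∈ Q := by
    refine ⟨Pi.single i 1, ?_, by rw [wt_single, one_smul]⟩
    rw [Set.mem_ofPred_eq, GCM.quadForm_single_one]
    linarith [hd.pos i]
  obtain ⟨k, hk, hwk⟩ := (MulAction.mem_stabilizer_set.1 (weylGroup_le hw) _).2 root_mem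
  exact ⟨k, hwk.symm, hk⟩

theorem coe_derivedAlgebra :
    (R.derivedAlgebra : Submodule K R.Algebra) =
      Submodule.span K {⁅x, y⁆ | (x : R.Algebra) (y : R.Algebra)} :=
  LieAlgebra.coe_derivedSeries_one_eq K R.Algebra

variable {R} in
theorem mem_derivedAlgebra_of_mem_rootSpace {β : Module.Dual K H} (hβ : β ≠ 0) {x : R.Algebra}
    (hx : x ∈ R.rootSpace β) : x ∈ R.derivedAlgebra := by
  obtain ⟨t, ht⟩ := DFunLike.ne_iff.1 hβ
  have h : ⁅R.h t, x⁆ ∈ (R.derivedAlgebra : Submodule K R.Algebra) := by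
    rw [coe_derivedAlgebra]
    exact Submodule.subset_span ⟨_, _, rfl⟩
  rw [hx t] at h
  exact (Submodule.smul_mem_iff _ ht).1 h

theorem derivedAlgebra_le_lieSpan_e_f :
    R.derivedAlgebra ≤ LieSubalgebra.lieSpan K R.Algebra (Set.range R.e ∪ Set.range R.f) := by
  set M := LieSubalgebra.lieSpan K R.Algebra (Set.range R.e ∪ Set.range R.f)
  have he (i : Fin n) : R.e i ∈ M := LieSubalgebra.subset_lieSpan (.inl ⟨i, rfl⟩)
  have hf (i : Fin n) : R.f i ∈ M := LieSubalgebra.subset_lieSpan (.inr ⟨i, rfl⟩)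
  have exists_weight : ∀ x ∈ Set.range R.e ∪ Set.range R.f, ∃ β, x ∈ R.rootSpace β := by
    rintro x (hx | hx)
    exacts [R.exists_mem_rootSpace_of_mem_range_e x hx, R.exists_mem_rootSpace_of_mem_range_f x hx]
  have normalizer_eq_top : M.normalizer = ⊤ :=
    eq_top_of_generators_mem
      (fun t => (LieSubalgebra.mem_normalizer_iff M _).2 fun _ =>
        R.lie_h_mem_lieSpan exists_weight t)
      (fun i => M.le_normalizer (he i)) fun i => M.le_normalizer (hf i)
  have lie_mem (x : R.Algebra) {y : R.Algebra} (hy : y ∈ M) : ⁅y, x⁆ ∈ M :=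
    (LieSubalgebra.mem_normalizer_iff' M x).1
      (normalizer_eq_top.ge (LieSubalgebra.mem_top x)) y hy
  have annihilatorMod_eq_top {x : R.Algebra} (hx : ∀ t, ⁅R.h t, x⁆ ∈ M) :
      annihilatorMod M x = ⊤ :=
    eq_top_of_generators_mem
      (fun t => ⟨normalizer_eq_top.ge (LieSubalgebra.mem_top _), hx t⟩)
      (fun i => mem_annihilatorMod_of_mem (he i) (lie_mem x (he i)))
      fun i => mem_annihilatorMod_of_mem (hf i) (lie_mem x (hf i))
  have lie_h_mem (x : R.Algebra) (t : H) : ⁅R.h t, x⁆ ∈ M := by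
    have h := (annihilatorMod_eq_top fun s => R.lie_h_h s t ▸ zero_mem M).ge
      (LieSubalgebra.mem_top x)
    rw [← lie_skew]
    exact neg_mem h.2
  rw [← LieSubalgebra.toSubmodule_le_toSubmodule, coe_derivedAlgebra, Submodule.span_le]
  rintro _ ⟨x, y, rfl⟩
  exact ((annihilatorMod_eq_top (lie_h_mem y)).ge (LieSubalgebra.mem_top x)).2

open LieModule

section AdF

variable {R} {i : Fin n} {k : Fin n → ℤ} {u : R.Algebra}

theorem lie_h_coroot {p : ℕ} (hu : u ∈ R.rootSpace (R.wt k)) (hp : (A.a *ᵥ k) i = p) :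
    ⁅R.h (R.coroot i), u⁆ = (p : K) • u := by
  rw [hu, wt_coroot, hp, Int.cast_natCast]

theorem ad_f_pow_mem_rootSpace (hu : u ∈ R.rootSpace (R.wt k)) (p : ℕ) :
    (toEnd K R.Algebra R.Algebra (R.f i) ^ p) u ∈
      R.rootSpace (R.wt (k - Pi.single i (p : ℤ))) := by
  induction p with
  | zero => simpa using hu
  | succ p ih =>
    have h := R.lie_mem_rootSpace (R.f_mem_rootSpace i) ih
    rwa [← map_add, neg_add_eq_sub, sub_sub, ← Pi.single_add, ← toEnd_apply_apply K,
      ← Module.End.mul_apply, ← pow_succ', ← Nat.cast_succ] at h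

theorem ad_f_pow_mem {S : LieSubalgebra K R.Algebra} (hu : u ∈ S) (hf : R.f i ∈ S) (p : ℕ) :
    (toEnd K R.Algebra R.Algebra (R.f i) ^ p) u ∈ S := by
  induction p with
  | zero => exact hu
  | succ p ih =>
    rw [pow_succ', Module.End.mul_apply]
    exact S.lie_mem hf ih

end AdF

theorem iSupIndep_rootSpace : iSupIndep R.rootSpace := by
  have commute_ad_h (s t : H) :
      Commute (LieAlgebra.ad K R.Algebra (R.h s)) (LieAlgebra.ad K R.Algebra (R.h t)) := by
    ext x
    simp only [Module.End.mul_apply, LieAlgebra.ad_apply]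
    rw [leibniz_lie, lie_h_h, zero_lie, zero_add]
  have h := Module.End.independent_iInf_maxGenEigenspace_of_forall_mapsTo
    (fun t : H => LieAlgebra.ad K R.Algebra (R.h t))
    fun s t μ => Module.End.mapsTo_maxGenEigenspace_of_comm (commute_ad_h t s) μ
  refine (h.comp (f := fun β : Module.Dual K H => (β : H → K)) DFunLike.coe_injective).mono ?_
  intro β x hx
  simp only [Function.comp_apply, Submodule.mem_iInf, Module.End.mem_maxGenEigenspace]
  exact fun t => ⟨1, by simp [hx t]⟩

/-- The weight vectors of weight `s • k` for some `k ≥ 0` that involves at least two simple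
roots. -/
def nontrivialSupportVectors (s : ℤ) : Set R.Algebra :=
  {y | ∃ k : Fin n → ℤ, 0 ≤ k ∧ (Function.support k).Nontrivial ∧ y ∈ R.rootSpace (R.wt (s • k))}

theorem lie_mem_nontrivialSupportVectors {s : ℤ} {k l : Fin n → ℤ} (hk : 0 ≤ k) (hl : 0 ≤ l)
    {a b : R.Algebra} (ha : a ∈ R.rootSpace (R.wt (s • k))) (hb : b ∈ R.rootSpace (R.wt (s • l)))
    {i j : Fin n} (hij : i ≠ j) (hi : k i ≠ 0 ∨ l i ≠ 0) (hj : k j ≠ 0 ∨ l j ≠ 0) :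
    ⁅a, b⁆ ∈ R.nontrivialSupportVectors s := by
  refine ⟨k + l, add_nonneg hk hl, support_add_nontrivial hk hl hij hi hj, ?_⟩
  rw [smul_add, map_add]
  exact R.lie_mem_rootSpace ha hb

theorem mem_span_of_mem_lieSpan {s : ℤ} {x : Fin n → R.Algebra}
    (hx : ∀ j, x j ∈ R.rootSpace (R.wt (s • Pi.single j 1))) {y : R.Algebra}
    (hy : y ∈ LieSubalgebra.lieSpan K R.Algebra (Set.range x)) :
    y ∈ Submodule.span K (Set.range x ∪ R.nontrivialSupportVectors s) := by
  induction hy using LieSubalgebra.lieSpan_induction with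
  | mem y hy => exact Submodule.subset_span (.inl hy)
  | zero => exact zero_mem _
  | add y z _ _ hy hz => exact add_mem hy hz
  | smul c y _ hy => exact Submodule.smul_mem _ c hy
  | lie y z _ _ hy hz =>
    have h0 (j : Fin n) : 0 ≤ (Pi.single j 1 : Fin n → ℤ) := Pi.single_nonneg.2 zero_le_one
    refine lie_mem_of_mem_span ?_ hy hz
    rintro _ (⟨i, rfl⟩ | ⟨k, hk, ⟨p, hp, q, hq, hpq⟩, ha⟩) _
      (⟨j, rfl⟩ | ⟨l, hl, ⟨p', hp', q', hq', hpq'⟩, hb⟩)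
    · rcases eq_or_ne i j with rfl | hij
      · rw [lie_self]
        exact zero_mem _
      · exact Submodule.subset_span (.inr (R.lie_mem_nontrivialSupportVectors (h0 i) (h0 j)
          (hx i) (hx j) hij (by simp) (by simp)))
    · exact Submodule.subset_span (.inr (R.lie_mem_nontrivialSupportVectors (h0 i) hl (hx i) hb
        hpq' (.inr hp') (.inr hq')))
    · exact Submodule.subset_span (.inr (R.lie_mem_nontrivialSupportVectors hk (h0 j) ha (hx j)
        hpq (.inl hp) (.inl hq)))
    · exact Submodule.subset_span (.inr (R.lie_mem_nontrivialSupportVectors hk hl ha hb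
        hpq (.inl hp) (.inl hq)))

/-- The vectors of weight `k` that occur in the triangular decomposition: those of weight
`k ≤ 0`, the `e j`, and those of weight `k ≥ 0` involving at least two simple roots. They turn out
to span the whole weight space. -/
def rootSpanningSet (k : Fin n → ℤ) : Set R.Algebra :=
  {x | x ∈ R.rootSpace (R.wt k) ∧
    (k ≤ 0 ∨ (∃ j, k = Pi.single j 1 ∧ x = R.e j) ∨ (0 ≤ k ∧ (Function.support k).Nontrivial))}

theorem iSup_span_rootSpanningSet : ⨆ k, Submodule.span K (R.rootSpanningSet k) = ⊤ := by
  set M := ⨆ k, Submodule.span K (R.rootSpanningSet k)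
  have mem_M {k : Fin n → ℤ} {x : R.Algebra} (hx : x ∈ R.rootSpanningSet k) : x ∈ M :=
    Submodule.mem_iSup_of_mem k (Submodule.subset_span hx)
  have single_nonneg (j : Fin n) : 0 ≤ (Pi.single j 1 : Fin n → ℤ) :=
    Pi.single_nonneg.2 zero_le_one
  rw [eq_top_iff, ← R.cartan_sup_nPos_sup_nNeg]
  refine sup_le (sup_le ?_ fun x hx => ?_) fun x hx => ?_
  · rintro _ ⟨t, rfl⟩
    refine mem_M (k := 0) ⟨fun s => ?_, .inl le_rfl⟩
    rw [map_zero, LinearMap.zero_apply, zero_smul]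
    exact R.lie_h_h s t
  · refine Submodule.span_le.2 ?_ (R.mem_span_of_mem_lieSpan (s := 1) (fun j => ?_) hx)
    · rintro _ (⟨j, rfl⟩ | ⟨k, hk, hsupp, hy⟩)
      · exact mem_M ⟨R.e_mem_rootSpace j, .inr (.inl ⟨j, rfl, rfl⟩)⟩
      · rw [one_smul] at hy
        exact mem_M ⟨hy, .inr (.inr ⟨hk, hsupp⟩)⟩
    · rw [one_smul]
      exact R.e_mem_rootSpace j
  · refine Submodule.span_le.2 ?_ (R.mem_span_of_mem_lieSpan (s := -1) (fun j => ?_) hx)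
    · rintro _ (⟨j, rfl⟩ | ⟨k, hk, -, hy⟩)
      · exact mem_M ⟨R.f_mem_rootSpace j, .inl (neg_nonpos.2 (single_nonneg j))⟩
      · rw [neg_one_smul] at hy
        exact mem_M ⟨hy, .inl (neg_nonpos.2 hk)⟩
    · rw [neg_one_smul]
      exact R.f_mem_rootSpace j

variable [CharZero K]

theorem span_rootSpanningSet (k : Fin n → ℤ) :
    Submodule.span K (R.rootSpanningSet k) = R.rootSpace (R.wt k) := by
  have hindep : iSupIndep fun k => R.rootSpace (R.wt k) := R.iSupIndep_rootSpace.comp R.wt_injective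
  have hle (k : Fin n → ℤ) : Submodule.span K (R.rootSpanningSet k) ≤ R.rootSpace (R.wt k) :=
    Submodule.span_le.2 fun x hx => hx.1
  exact congrFun ((hindep.le_iff_eq_of_iSup_eq_top R.iSup_span_rootSpanningSet).1 hle) k

variable {R}

theorem exists_eq_smul_e {j : Fin n} {c : ℤ} (hc : 0 < c) {x : R.Algebra}
    (hx : x ∈ R.rootSpace (R.wt (Pi.single j c))) : ∃ b : K, x = b • R.e j := by
  have hle : R.rootSpanningSet (Pi.single j c) ⊆ {R.e j} := by
    rintro y ⟨-, h | ⟨i, h, rfl⟩ | ⟨-, hsupp⟩⟩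
    · exact absurd (Pi.single_nonpos.1 h) hc.not_ge
    · obtain rfl : j = i := by
        by_contra hji
        exact hc.ne' (by simpa [hji] using congrFun h j)
      rfl
    · exact absurd (Set.subsingleton_singleton.anti Pi.support_single_subset)
        (Set.not_subsingleton_iff.2 hsupp)
  rw [← span_rootSpanningSet] at hx
  obtain ⟨b, hb⟩ := Submodule.mem_span_singleton.1 (Submodule.span_mono hle hx)
  exact ⟨b, hb.symm⟩

theorem nonneg_of_mem_rootSpace {k : Fin n → ℤ} {j : Fin n} (hj : 0 < k j) {x : R.Algebra}
    (hx : x ∈ R.rootSpace (R.wt k)) (hx0 : x ≠ 0) : 0 ≤ k := by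
  by_contra hk
  have hempty : R.rootSpanningSet k = ∅ := by
    refine Set.eq_empty_of_forall_notMem ?_
    rintro y ⟨-, h | ⟨i, rfl, -⟩ | ⟨h, -⟩⟩
    exacts [(h j).not_gt hj, hk (Pi.single_nonneg.2 zero_le_one), hk h]
  rw [← span_rootSpanningSet, hempty, Submodule.span_empty, Submodule.mem_bot] at hx
  exact hx0 hx

variable {i : Fin n} {k : Fin n → ℤ} {u : R.Algebra}

theorem isSl2Triple (hu : u ∈ R.rootSpace (R.wt k)) (hu0 : u ≠ 0) (hk : (A.a *ᵥ k) i ≠ 0) :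
    IsSl2Triple (R.h (R.coroot i)) (R.e i) (R.f i) where
  h_ne_zero h := by
    have := hu (R.coroot i)
    rw [h, zero_lie, wt_coroot, eq_comm, smul_eq_zero, Int.cast_eq_zero] at this
    exact this.elim hk hu0
  lie_e_f := R.lie_e_f_same i
  lie_h_e_nsmul := by
    rw [lie_h_e, R.root_coroot, A.diag, Int.cast_ofNat, ofNat_smul_eq_nsmul]
  lie_h_f_nsmul := by
    rw [lie_h_f, R.root_coroot, A.diag, Int.cast_ofNat, ofNat_smul_eq_nsmul]

theorem ad_f_pow_ne_zero {p : ℕ} (hu : u ∈ R.rootSpace (R.wt k)) (hu0 : u ≠ 0)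
    (hp : (A.a *ᵥ k) i = p) : (toEnd K R.Algebra R.Algebra (R.f i) ^ p) u ≠ 0 := by
  rcases eq_or_ne p 0 with rfl | hp0
  · exact hu0
  · have t := isSl2Triple hu hu0 (hp ▸ Nat.cast_ne_zero.2 hp0)
    exact fun h => hu0 (eq_zero_of_pow_toEnd_f_eq_zero t (lie_h_coroot hu hp)
      (R.exists_ad_e_pow_eq_zero i u) h)

theorem lie_e_ad_f_pow {r : ℕ} (hu : u ∈ R.rootSpace (R.wt k)) (hu0 : u ≠ 0)
    (hr : (A.a *ᵥ k) i = (r + 1 : ℕ))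
    (hf : (toEnd K R.Algebra R.Algebra (R.f i) ^ (r + 2)) u = 0) :
    ⁅R.e i, (toEnd K R.Algebra R.Algebra (R.f i) ^ (r + 1)) u⁆ =
      ((r + 1 : ℕ) : K) • (toEnd K R.Algebra R.Algebra (R.f i) ^ r) u := by
  have t := isSl2Triple hu hu0 (hr ▸ Nat.cast_ne_zero.2 r.succ_ne_zero)
  have hh := lie_h_coroot hu hr
  have heu : ⁅R.e i, u⁆ = 0 :=
    lie_e_eq_zero_of_pow_succ_toEnd_f_eq_zero t hh (R.exists_ad_e_pow_eq_zero i u) hf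
  rw [lie_e_pow_succ_toEnd_f t hh, heu, map_zero, zero_add]
  congr 1
  push_cast
  ring

theorem reflect_nonneg (hk : 0 ≤ k) (hu : u ∈ R.rootSpace (R.wt k)) (hu0 : u ≠ 0)
    (hi : 0 < (A.a *ᵥ k) i) (hsupp : ∃ l ≠ i, k l ≠ 0) : 0 ≤ A.reflect i k := by
  obtain ⟨l, hli, hl⟩ := hsupp
  obtain ⟨p, hp⟩ := Int.eq_ofNat_of_zero_le hi.le
  refine nonneg_of_mem_rootSpace (j := l) ?_ ?_ (ad_f_pow_ne_zero hu hu0 hp)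
  · rw [GCM.reflect_apply_of_ne hli]
    exact (hk l).lt_of_ne' hl
  · rw [GCM.reflect, hp]
    exact ad_f_pow_mem_rootSpace hu p

theorem e_mem_of_apply_eq_zero {S : LieSubalgebra K R.Algebra}
    (huS : u ∈ S) (hf : ∀ j, k j ≠ 0 → R.f j ∈ S) (hki : k i = 0) (hi : (A.a *ᵥ k) i ≠ 0)
    (hue : ⁅u, R.e i⁆ ∈ S)
    (he : ∀ T : LieSubalgebra K R.Algebra, u ∈ T → (∀ j, k j ≠ 0 → R.f j ∈ T) →
      ∀ j, k j ≠ 0 → R.e j ∈ T) :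
    R.e i ∈ S := by
  have ne_i {j : Fin n} (hj : k j ≠ 0) : j ≠ i := fun h => hj (h ▸ hki)
  set T := annihilatorMod S (R.e i)
  have hfT (j : Fin n) (hj : k j ≠ 0) : R.f j ∈ T := by
    refine mem_annihilatorMod_of_mem (hf j hj) ?_
    rw [← lie_skew, R.lie_e_f_of_ne (ne_i hj).symm, neg_zero]
    exact zero_mem S
  have heT := he T (mem_annihilatorMod_of_mem huS hue) hfT
  obtain ⟨j, hj, hij⟩ : ∃ j, k j ≠ 0 ∧ A.a i j ≠ 0 := by
    contrapose! hi
    change ∑ j, A.a i j * k j = 0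
    refine Finset.sum_eq_zero fun j _ => ?_
    by_cases hj : k j = 0
    · rw [hj, mul_zero]
    · rw [hi j hj, zero_mul]
  have hji : A.a j i ≠ 0 := fun h => hij ((A.zero_iff j i (ne_i hj)).1 h)
  have hhT : ⁅R.e j, R.f j⁆ ∈ T := T.lie_mem (heT j hj) (hfT j hj)
  have he_smul : (A.a j i : K) • R.e i ∈ S := by
    rw [← R.root_coroot, ← lie_h_e, ← lie_e_f_same]
    exact (mem_annihilatorMod.1 hhT).2
  exact (S.smul_mem_iff (Int.cast_ne_zero.2 hji)).1 he_smul

theorem e_mem_of_mem_rootSpace_single {S : LieSubalgebra K R.Algebra} {c : ℤ} (hc : 0 < c)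
    (hu : u ∈ R.rootSpace (R.wt (Pi.single i c))) (hu0 : u ≠ 0) (huS : u ∈ S) : R.e i ∈ S := by
  obtain ⟨b, rfl⟩ := exists_eq_smul_e hc hu
  exact (S.smul_mem_iff (left_ne_zero_of_smul hu0)).1 huS

theorem lie_ad_f_pow_e_mem {S : LieSubalgebra K R.Algebra} {r : ℕ}
    (hu : u ∈ R.rootSpace (R.wt k)) (hu0 : u ≠ 0) (huS : u ∈ S) (hf : R.f i ∈ S)
    (hr : (A.a *ᵥ k) i = (r + 1 : ℕ)) (hki : A.reflect i k i = 0) (hsupp : ∃ l ≠ i, 0 < k l) :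
    ⁅(toEnd K R.Algebra R.Algebra (R.f i) ^ (r + 1)) u, R.e i⁆ ∈ S := by
  have hf0 : (toEnd K R.Algebra R.Algebra (R.f i) ^ (r + 2)) u = 0 := by
    by_contra h0
    obtain ⟨l, hli, hl⟩ := hsupp
    have := nonneg_of_mem_rootSpace (j := l) (by simpa [hli] using hl)
      (ad_f_pow_mem_rootSpace hu (r + 2)) h0 i
    simp only [Pi.zero_apply, Nat.cast_add, Nat.cast_ofNat, Pi.sub_apply, Pi.single_eq_same,
      Int.sub_nonneg, GCM.reflect] at this hki
    omega
  rw [← lie_skew, lie_e_ad_f_pow hu hu0 hr hf0]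
  exact neg_mem (S.smul_mem _ (ad_f_pow_mem huS hf r))

theorem e_mem_of_reflect {S : LieSubalgebra K R.Algebra} {r : ℕ} (hk : 0 ≤ k)
    (hu : u ∈ R.rootSpace (R.wt k)) (hu0 : u ≠ 0) (huS : u ∈ S) (hf : ∀ j, k j ≠ 0 → R.f j ∈ S)
    (hki : k i ≠ 0) (hr : (A.a *ᵥ k) i = (r + 1 : ℕ)) (hsupp : ∃ l ≠ i, k l ≠ 0)
    (he : ∀ T : LieSubalgebra K R.Algebra,
      (toEnd K R.Algebra R.Algebra (R.f i) ^ (r + 1)) u ∈ T →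
      (∀ j, A.reflect i k j ≠ 0 → R.f j ∈ T) → ∀ j, A.reflect i k j ≠ 0 → R.e j ∈ T) :
    ∀ l, k l ≠ 0 → R.e l ∈ S := by
  have hu'S := ad_f_pow_mem huS (hf i hki) (r + 1)
  have hf' (j : Fin n) (hj : A.reflect i k j ≠ 0) : R.f j ∈ S := by
    rcases eq_or_ne j i with rfl | hji
    · exact hf j hki
    · exact hf j (by rwa [GCM.reflect_apply_of_ne hji] at hj)
  intro l hl
  rcases ne_or_eq (A.reflect i k l) 0 with hl' | hl'
  · exact he S hu'S hf' l hl'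
  · obtain rfl : l = i := by
      by_contra hli
      exact hl (by rwa [GCM.reflect_apply_of_ne hli] at hl')
    refine e_mem_of_apply_eq_zero hu'S hf' hl' ?_ ?_ he
    · rw [GCM.mulVec_reflect_self, hr]
      exact neg_ne_zero.2 (Nat.cast_ne_zero.2 r.succ_ne_zero)
    · obtain ⟨j, hj, hj0⟩ := hsupp
      exact lie_ad_f_pow_e_mem hu hu0 huS (hf l hl) hr hl' ⟨j, hj, (hk j).lt_of_ne' hj0⟩

theorem e_mem_of_mem_rootSpace {d : Fin n → ℤ} (hd : A.IsSymmetrizer d)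
    {S : LieSubalgebra K R.Algebra} (hk : 0 ≤ k) (hq : 0 < A.quadForm d k)
    (hu : u ∈ R.rootSpace (R.wt k)) (hu0 : u ≠ 0) (huS : u ∈ S)
    (hf : ∀ j, k j ≠ 0 → R.f j ∈ S) : ∀ l, k l ≠ 0 → R.e l ∈ S := by
  induction hm : (∑ j, k j).toNat using Nat.strong_induction_on generalizing S k u with
  | _ m ih =>
  obtain ⟨i, hi, hAi⟩ := hd.exists_pos_pos_of_quadForm_pos hk hq
  by_cases hsupp : ∃ l ≠ i, k l ≠ 0
  · obtain ⟨r, hr⟩ := Int.eq_succ_of_zero_lt hAi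
    have hk' : 0 ≤ A.reflect i k := reflect_nonneg hk hu hu0 hAi hsupp
    have hsum : (∑ j, A.reflect i k j).toNat < m := by
      have := Finset.sum_nonneg fun j (_ : j ∈ Finset.univ) => hk' j
      simp only [GCM.reflect, Pi.sub_apply, Finset.sum_sub_distrib, Finset.sum_pi_single',
        Finset.mem_univ, ↓reduceIte, Int.sub_nonneg] at this ⊢
      omega
    have hu' := ad_f_pow_mem_rootSpace (i := i) hu (r + 1)
    rw [Nat.cast_succ, ← hr, ← GCM.reflect] at hu'
    exact e_mem_of_reflect hk hu hu0 huS hf hi.ne' hr hsupp fun T huT hfT =>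
      ih _ hsum hk' (by rwa [hd.quadForm_reflect]) hu' (ad_f_pow_ne_zero hu hu0 hr) huT hfT rfl
  · push Not at hsupp
    have hk_eq : k = Pi.single i (k i) := by
      ext l
      rcases eq_or_ne l i with rfl | hli
      · simp
      · simp [hli, hsupp l hli]
    intro l hl
    obtain rfl : l = i := by
      by_contra hli
      exact hl (hsupp l hli)
    rw [hk_eq] at hu
    exact e_mem_of_mem_rootSpace_single hi hu hu0 huS

variable (R) in
theorem wt_ne_zero (hk : k ≠ 0) : R.wt k ≠ 0 := (map_ne_zero_iff _ R.wt_injective).2 hk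

variable (R) in
theorem f_mem_derivedAlgebra (i : Fin n) : R.f i ∈ R.derivedAlgebra :=
  mem_derivedAlgebra_of_mem_rootSpace (R.wt_ne_zero (neg_ne_zero.2 (by simp)))
    (R.f_mem_rootSpace i)

theorem IsPositive.nonneg (hk : R.IsPositive (R.wt k)) : 0 ≤ k := by
  obtain ⟨p, hp⟩ := hk
  have : k = fun i => (p i : ℤ) := R.wt_injective (by simpa [wt_apply] using hp)
  exact this ▸ fun i => Int.natCast_nonneg (p i)

theorem HasMaximalSupport.ne_zero (hk : R.HasMaximalSupport (R.wt k)) : ∀ i, k i ≠ 0 := by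
  obtain ⟨s, hs, hs0⟩ := hk
  rw [← wt_apply] at hs
  exact R.wt_injective hs ▸ hs0

end Realization

end KacMoody

end

theorem mainTheorem7_general {n : ℕ} {A : KacMoody.GCM n} {d : Fin n → ℤ} (hd : A.IsSymmetrizer d)
    {K : Type*} [Field K] [CharZero K] {H : Type*} [AddCommGroup H] [Module K H]
    (R : KacMoody.Realization A K H) (β : Module.Dual K H) (hreal : R.IsRealRoot β)
    (hpos : R.IsPositive β) (hsupp : R.HasMaximalSupport β)
    (eβ : R.Algebra) (heβ : eβ ∈ R.rootSpace β) (heβ0 : eβ ≠ 0) :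
    LieSubalgebra.lieSpan K R.Algebra (insert eβ (Set.range R.f)) = R.derivedAlgebra := by
  obtain ⟨k, rfl, hq⟩ := hreal.exists_quadForm_pos hd
  have hk : 0 ≤ k := hpos.nonneg
  have hk0 : ∀ i, k i ≠ 0 := hsupp.ne_zero
  have hwt : R.wt k ≠ 0 := R.wt_ne_zero (KacMoody.GCM.ne_zero_of_quadForm_pos hq)
  set S := LieSubalgebra.lieSpan K R.Algebra (insert eβ (Set.range R.f))
  have heβS : eβ ∈ S := LieSubalgebra.subset_lieSpan (.inl rfl)
  have hfS (i : Fin n) : R.f i ∈ S := LieSubalgebra.subset_lieSpan (.inr ⟨i, rfl⟩)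
  have heS (i : Fin n) : R.e i ∈ S :=
    KacMoody.Realization.e_mem_of_mem_rootSpace hd hk hq heβ heβ0 heβS (fun j _ => hfS j) i (hk0 i)
  refine le_antisymm (LieSubalgebra.lieSpan_le.2 ?_)
    (R.derivedAlgebra_le_lieSpan_e_f.trans (LieSubalgebra.lieSpan_le.2 ?_))
  · rintro _ (rfl | ⟨i, rfl⟩)
    exacts [KacMoody.Realization.mem_derivedAlgebra_of_mem_rootSpace hwt heβ,
      R.f_mem_derivedAlgebra i]
  · rintro _ (⟨i, rfl⟩ | ⟨i, rfl⟩)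
    exacts [heS i, hfS i]

theorem mainTheorem7 {n : ℕ} (A : KacMoody.GCM n) (hirr : A.IsIrreducible)
    (hsl : A.IsSimplyLaced) {K : Type*} [RCLike K] {H : Type*} [AddCommGroup H] [Module K H]
    (R : KacMoody.Realization A K H) (β : Module.Dual K H) (hreal : R.IsRealRoot β)
    (hpos : R.IsPositive β) (hsupp : R.HasMaximalSupport β)
    (eβ : R.Algebra) (heβ : eβ ∈ R.rootSpace β) (heβ0 : eβ ≠ 0) :
    LieSubalgebra.lieSpan K R.Algebra (insert eβ (Set.range R.f)) = R.derivedAlgebra :=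
  mainTheorem7_general hsl.isSymmetrizer_one R β hreal hpos hsupp eβ heβ heβ0
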